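/- All terms are as follows. Let $X$ be a topological space and $\mathcal A\subseteq\mathcal P(X)$. $X$ is $\mathcal A$-selectively pseudocompact ($\mathcal A$-SP) if for every sequence $\langle U_n:n\in\omega\rangle$ of non-empty open subsets of $X$ one can choose $A_n\in\mathcal A$ with $A_n\subseteq U_n$ ($n\in\omega$) such that the family $\langle A_n:n\in\omega\rangle$ is not locally finite, i.e. there is a point $x\in X$ every neighbourhood of which meets $A_n$ for infinitely many $n$. A set $Y\subseteq X$ is scattered if every non-empty subset of $Y$ has a relatively isolated point. $X$ is called $1$-SP, fin-SP, ClScat-SP, Scat-SP, Nwd-SP if it is $\mathcal A$-SP where $\mathcal A$ is the family of all one-point, finite, closed scattered, scattered, nowhere dense subsets of $X$, respectively. $X$ is pseudocompact if every continuous function $X\to\mathbb R$ is bounded; countably tight if whenever $x\in\overline A$ there is a countable $B\subseteq A$ with $x\in\overline B$; $0$-dimensional if its clopen sets form a base; crowded if it has no isolated points. **Theorem.** (a) For every crowded $T_1$ space, each of the following implications holds: $1$-SP $\Rightarrow$ fin-SP $\Rightarrow$ ClScat-SP $\Rightarrow$ Scat-SP $\Rightarrow$ Nwd-SP $\Rightarrow$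 pseudocompact. (b) Assume the continuum hypothesis $2^{\aleph_0}=\aleph_1$. Then there are crowded, countably tight, $0$-dimensional Hausdorff spaces $X_1,X_2,X_3,X_4$ such that 1. $X_1$ is fin-SP, but not $1$-SP; 2. $X_2$ is ClScat-SP, but not fin-SP; 3. $X_3$ is Scat-SP, but not ClScat-SP; 4. $X_4$ is pseudocompact, but not Nwd-SP. Hence, under the continuum hypothesis, the first three implications in (a) are not reversible, and pseudocompactness does not imply Nwd-SP. -/

import Mathlib

open scoped Cardinal

namespace SelPseudo

/-- `X` is `𝒜`-selectively pseudocompact: for every sequence of non-empty open sets `U n` one can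
pick `A n ∈ 𝒜` with `A n ⊆ U n` such that the family `(A n)` has an accumulation point, that is,
it is not locally finite (some point has all its neighbourhoods meet `A n` for infinitely
many `n`). -/
def SP (X : Type*) [TopologicalSpace X] (𝒜 : Set (Set X)) : Prop :=
  ∀ U : ℕ → Set X, (∀ n, IsOpen (U n)) → (∀ n, (U n).Nonempty) →
    ∃ A : ℕ → Set X, (∀ n, A n ∈ 𝒜) ∧ (∀ n, A n ⊆ U n) ∧ ¬ LocallyFinite A

/-- A subset of a space is scattered if each of its non-empty subsets has a (relatively)
isolated point. -/
def IsScattered {X : Type*} [TopologicalSpace X] (Y : Set X) : Prop :=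
  ∀ Z ⊆ Y, Z.Nonempty → ∃ z ∈ Z, ∃ V : Set X, IsOpen V ∧ V ∩ Z = {z}

/-- The family of all one-point subsets of `X`. -/
def Singletons (X : Type*) : Set (Set X) := {Y | ∃ x, Y = {x}}

/-- The family of all finite subsets of `X`. -/
def FinSets (X : Type*) : Set (Set X) := {Y | Y.Finite}

/-- The family of all closed scattered subsets of `X`. -/
def ClScat (X : Type*) [TopologicalSpace X] : Set (Set X) := {Y | IsClosed Y ∧ IsScattered Y}

/-- The family of all scattered subsets of `X`. -/
def Scat (X : Type*) [TopologicalSpace X] : Set (Set X) := {Y | IsScattered Y}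

/-- The family of all nowhere dense subsets of `X`. -/
def Nwd (X : Type*) [TopologicalSpace X] : Set (Set X) := {Y | IsNowhereDense Y}

/-- `X` is pseudocompact: every continuous real-valued function on `X` is bounded. -/
def IsPseudocompact (X : Type*) [TopologicalSpace X] : Prop :=
  ∀ f : X → ℝ, Continuous f → ∃ M : ℝ, ∀ x, |f x| ≤ M

/-- `X` is countably tight: a point in the closure of a set is in the closure of some countable
subset of it. -/
def IsCountablyTight (X : Type*) [TopologicalSpace X] : Prop :=
  ∀ (A : Set X) (x : X), x ∈ closure A → ∃ B ⊆ A, B.Countable ∧ x ∈ closure B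

/-- `X` is zero-dimensional: its clopen sets form a base. -/
def IsZeroDimensional (X : Type*) [TopologicalSpace X] : Prop :=
  TopologicalSpace.IsTopologicalBasis {s : Set X | IsClopen s}

/-- Countably tight, zero-dimensional, crowded (dense-in-itself) Hausdorff spaces. -/
structure IsNice (X : Type*) [TopologicalSpace X] : Prop where
  countablyTight : IsCountablyTight X
  zeroDimensional : IsZeroDimensional X
  hausdorff : T2Space X
  crowded : PerfectSpace X

end SelPseudo

namespace SelPseudo

open Set Filter Topology

/-! In a crowded `T₁` space the listed families increase, which gives all implications but the last;
and if `f` is unbounded, every selection from the open sets `{|f| > n}` is locally finite.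

For the separations, glue countably many copies of the Cantor set `Y` to a Σ-product of two-point
spaces over `ω₁`: the point `y` of the `n`-th copy gets `i`-th coordinate `false` exactly when `y ∈
W i n`. The clopen sets `W i n` come from a recursion on `i` with two competing demands. If `T j` is
the `j`-th sequence from `𝒯`, then `W i n` must miss `T j n` for `i ≥ j` and large `n`; the copies
of the `T j n` are then locally finite, as each point of the Σ-product is `false` at some `i ≥ j`.
But each open sequence `V i` must contain sets `A i n` from `𝒜` accumulating in the Σ-product, so `A
i n` must keep meeting finite intersections of later `W`s.

Both demands can be met if `A i n` is `Big`, that is, survives many rounds of avoiding members of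
`𝒯`. A new `W` costs one round, the number of available rounds is unbounded along an ultrafilter,
and each stage has only countably many requirements, treated diagonally. The continuum hypothesis
lets `ω₁` list all the sequences. Open sequences that do not run off through the levels are handled
by compactness (`Glue.sp`).

It remains to find big sets (`exists_isNice_sp`): large finite sets against points, iterated
convergent sequences against finite sets, scattered sets with non-scattered closure against closed
scattered sets, and open sets against closed nowhere dense sets. -/

/-! ### The chain of implications. -/

theorem SP.mono {X : Type*} [TopologicalSpace X] {𝒜 ℬ : Set (Set X)} (h : 𝒜 ⊆ ℬ) (hX : SP X 𝒜) :
    SP X ℬ := by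
  intro U hU hne
  obtain ⟨A, hA, hAU, hlf⟩ := hX U hU hne
  exact ⟨A, fun n => h (hA n), hAU, hlf⟩

theorem SP.isPseudocompact {X : Type*} [TopologicalSpace X] {𝒜 : Set (Set X)} (hX : SP X 𝒜) :
    IsPseudocompact X := by
  intro f hf
  by_contra! hunb
  obtain ⟨A, -, hAU, hlf⟩ := hX (fun n : ℕ => {x | (n : ℝ) < |f x|})
    (fun n => isOpen_lt continuous_const hf.abs) (fun n => hunb n)
  refine hlf fun x => ⟨{y | |f y| < |f x| + 1},
    (isOpen_lt hf.abs continuous_const).mem_nhds (by simp), ?_⟩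
  obtain ⟨N, hN⟩ := exists_nat_gt (|f x| + 1)
  refine (finite_lt_nat N).subset ?_
  rintro n ⟨y, hyA, hy⟩
  have h1 : (n : ℝ) < |f y| := hAU n hyA
  have h2 : |f y| < |f x| + 1 := hy
  exact_mod_cast (h1.trans h2).trans hN

theorem isScattered_of_finite {X : Type*} [TopologicalSpace X] [T1Space X] {A : Set X}
    (hA : A.Finite) : IsScattered A := by
  rintro Z hZ ⟨z, hz⟩
  refine ⟨z, hz, (Z \ {z})ᶜ, ((hA.subset hZ).subset sdiff_subset).isClosed.isOpen_compl, ?_⟩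
  ext y
  by_cases hy : y = z <;> simp_all

/-- A non-empty open subset of `closure Y` remains non-empty and open when one point is removed,
hence still meets `Y`; so `interior (closure Y) ∩ Y` has no isolated point. -/
theorem IsScattered.isNowhereDense {X : Type*} [TopologicalSpace X] [T1Space X] [PerfectSpace X]
    {Y : Set X} (hY : IsScattered Y) : IsNowhereDense Y := by
  rw [IsNowhereDense, ← not_nonempty_iff_eq_empty]
  rintro ⟨x, hx⟩
  obtain ⟨y, hyW, hyY⟩ := mem_closure_iff.1 (interior_subset hx) _ isOpen_interior hx
  obtain ⟨z, ⟨hzW, -⟩, V, hV, hVz⟩ := hY (interior (closure Y) ∩ Y) inter_subset_right ⟨y, hyW, hyY⟩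
  have hzV : z ∈ V := (hVz.symm ▸ mem_singleton z : z ∈ V ∩ _).1
  have ho : IsOpen (V ∩ interior (closure Y)) := hV.inter isOpen_interior
  obtain ⟨w, ⟨hwV, hwW⟩, hwz⟩ : ((V ∩ interior (closure Y)) \ {z}).Nonempty := by
    have hnt := (infinite_of_mem_nhds z (ho.mem_nhds ⟨hzV, hzW⟩)).sdiff (finite_singleton z)
    exact hnt.nonempty
  obtain ⟨v, ⟨⟨hvV, hvW⟩, hvz⟩, hvY⟩ := mem_closure_iff.1 (interior_subset hwW)
    ((V ∩ interior (closure Y)) \ {z}) (ho.sdiff isClosed_singleton) ⟨⟨hwV, hwW⟩, hwz⟩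
  have hv : v ∈ V ∩ (interior (closure Y) ∩ Y) := ⟨hvV, hvW, hvY⟩
  rw [hVz] at hv
  exact hvz hv

theorem sp_implications (X : Type*) [TopologicalSpace X] [T1Space X] [PerfectSpace X] :
    (SP X (Singletons X) → SP X (FinSets X)) ∧ (SP X (FinSets X) → SP X (ClScat X)) ∧
      (SP X (ClScat X) → SP X (Scat X)) ∧ (SP X (Scat X) → SP X (Nwd X)) ∧
      (SP X (Nwd X) → IsPseudocompact X) := by
  refine ⟨SP.mono ?_, SP.mono ?_, SP.mono ?_, SP.mono ?_, SP.isPseudocompact⟩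
  · rintro _ ⟨x, rfl⟩
    exact finite_singleton x
  · exact fun A hA => ⟨Finite.isClosed hA, isScattered_of_finite hA⟩
  · exact fun A hA => hA.2
  · exact fun A hA => IsScattered.isNowhereDense hA

/-! ### Big sets and diagonal choice of clopen sets. -/

/-- `A` survives `k` rounds of shrinking to a clopen subset, where each round has to avoid `n`
prescribed members of `𝒯`. -/
def Big {Y : Type*} [TopologicalSpace Y] (𝒯 : Set (Set Y)) (n : ℕ) : ℕ → Set Y → Prop
  | 0, A => A.Nonempty
  | k + 1, A => ∀ s : ℕ → Set Y, (∀ i, s i ∈ 𝒯) →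
      ∃ W, IsClopen W ∧ (∀ i < n, Disjoint W (s i)) ∧ Big 𝒯 n k (A ∩ W)

section Big

variable {Y : Type*} [TopologicalSpace Y] {𝒯 : Set (Set Y)} {n : ℕ}

theorem Big.mono {k : ℕ} {A B : Set Y} (h : A ⊆ B) (hA : Big 𝒯 n k A) : Big 𝒯 n k B := by
  induction k generalizing A B with
  | zero => exact Set.Nonempty.mono h hA
  | succ k ih =>
    intro s hs
    obtain ⟨W, hW, hd, hb⟩ := hA s hs
    exact ⟨W, hW, hd, ih (inter_subset_inter_left _ h) hb⟩

theorem Big.of_succ (h𝒯 : 𝒯.Nonempty) {k : ℕ} {A : Set Y} (hA : Big 𝒯 n (k + 1) A) :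
    Big 𝒯 n k A := by
  obtain ⟨t, ht⟩ := h𝒯
  obtain ⟨W, -, -, hb⟩ := hA (fun _ => t) fun _ => ht
  exact hb.mono inter_subset_left

theorem Big.of_le (h𝒯 : 𝒯.Nonempty) {k m : ℕ} (hmk : m ≤ k) {A : Set Y} (hA : Big 𝒯 n k A) :
    Big 𝒯 n m A := by
  induction hmk with
  | refl => exact hA
  | step _ ih => exact ih (hA.of_succ h𝒯)

/-- Each pair `(l, m)` has its own clopen set. The union of these finitely many sets serves all
pairs, because bigness is monotone. -/
theorem exists_isClopen_big_inter (n : ℕ) {t : ℕ → Set Y} (ht : ∀ i, t i ∈ 𝒯) (G : ℕ → Set Y) :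
    ∃ w, IsClopen w ∧ (∀ i < n, Disjoint w (t i)) ∧
      ∀ l < n, ∀ m < n, Big 𝒯 n (m + 1) (G l) → Big 𝒯 n m (G l ∩ w) := by
  have key : ∀ l m, ∃ w, IsClopen w ∧ (∀ i < n, Disjoint w (t i)) ∧
      (Big 𝒯 n (m + 1) (G l) → Big 𝒯 n m (G l ∩ w)) := by
    intro l m
    by_cases h : Big 𝒯 n (m + 1) (G l)
    · obtain ⟨w, h1, h2, h3⟩ := h t ht
      exact ⟨w, h1, h2, fun _ => h3⟩
    · exact ⟨∅, isClopen_empty, fun _ _ => empty_disjoint _, fun h' => absurd h' h⟩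
  choose w hw hd hb using key
  refine ⟨⋃ p ∈ Finset.range n ×ˢ Finset.range n, w p.1 p.2,
    isClopen_biUnion_finset fun p _ => hw _ _, fun i hi => ?_, fun l hl m hm h => ?_⟩
  · simp only [disjoint_iUnion_left]
    exact fun p _ => hd _ _ i hi
  · refine (hb l m h).mono (inter_subset_inter_right _ ?_)
    exact subset_biUnion_of_mem (u := fun p : ℕ × ℕ => w p.1 p.2) (x := (l, m)) (by simp [hl, hm])

/-- Diagonalisation: at index `n` only the first `n` entries of each list are treated, so each entry
is treated at all but finitely many indices. -/
theorem exists_isClopen_seq_big_inter {𝒢 𝒮 : Set (ℕ → Set Y)} (h𝒢 : 𝒢.Countable)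
    (h𝒮 : 𝒮.Countable) (hne : 𝒮.Nonempty) (h𝒮𝒯 : ∀ t ∈ 𝒮, ∀ n, t n ∈ 𝒯) :
    ∃ w : ℕ → Set Y, (∀ n, IsClopen (w n)) ∧ (∀ t ∈ 𝒮, ∀ᶠ n in atTop, Disjoint (w n) (t n)) ∧
      ∀ G ∈ 𝒢, ∀ m, ∀ᶠ n in atTop, Big 𝒯 n (m + 1) (G n) → Big 𝒯 n m (G n ∩ w n) := by
  -- The empty sequence is added because `𝒢` may be empty, as at the first stage of the recursion.
  obtain ⟨g, hg⟩ := (h𝒢.insert fun _ => ∅).exists_eq_range (insert_nonempty _ _)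
  obtain ⟨t, rfl⟩ := h𝒮.exists_eq_range hne
  have ht : ∀ i n, t i n ∈ 𝒯 := fun i n => h𝒮𝒯 _ (mem_range_self i) n
  choose w hw hd hb using fun n =>
    exists_isClopen_big_inter (𝒯 := 𝒯) n (t := fun i => t i n) (fun i => ht i n) fun i => g i n
  refine ⟨w, hw, ?_, fun G hG m => ?_⟩
  · rintro _ ⟨i, rfl⟩
    exact (eventually_gt_atTop i).mono fun n hn => hd n i hn
  · obtain ⟨l, rfl⟩ : G ∈ range g := hg ▸ mem_insert_of_mem _ hG
    filter_upwards [eventually_gt_atTop l, eventually_gt_atTop m] with n hl hm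
    exact hb n l hl m hm

end Big

/-! ### The transfinite recursion. -/

/-- A choice at `i` is possible only if the earlier choices are correct. So values are picked
blindly by `epsilon`, and correctness is proved afterwards by induction. -/
theorem exists_forall_of_wellFounded {I β : Type*} [Nonempty β] {r : I → I → Prop}
    (hr : WellFounded r) (R : I → (I → β) → β → Prop)
    (hcongr : ∀ i f g d, (∀ j, r j i → f j = g j) → R i f d → R i g d)
    (hex : ∀ i f, (∀ j, r j i → R j f (f j)) → ∃ d, R i f d) : ∃ f : I → β, ∀ i, R i f (f i) := by
  classical
  let extend : (i : I) → ((j : I) → r j i → β) → I → β :=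
    fun i prev j => if h : r j i then prev j h else Classical.arbitrary β
  let f : I → β := hr.fix fun i prev => Classical.epsilon (R i (extend i prev))
  have hf : ∀ i, f i = Classical.epsilon (R i (extend i fun j _ => f j)) := fun i => hr.fix_eq _ i
  have hext : ∀ i j, r j i → extend i (fun j _ => f j) j = f j := fun i j h => dif_pos h
  refine ⟨f, fun i => ?_⟩
  induction i using hr.induction with | _ i ih => ?_
  obtain ⟨d, hd⟩ := hex i f ih
  rw [hf i]
  exact hcongr i _ _ _ (hext i)
    (Classical.epsilon_spec ⟨d, hcongr i _ _ _ (fun j hj => (hext i j hj).symm) hd⟩)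

/-- The objects chosen at one step of the recursion: a sequence of clopen sets `W n`, a sequence of
sets `A n`, and an ultrafilter along which `A n` converges to the point `z`. -/
structure Stage (I Y : Type*) where
  W : ℕ → Set Y
  A : ℕ → Set Y
  𝒰 : Ultrafilter ℕ
  z : I → Bool

/-- The requirements on the step `i` of the recursion, given the earlier steps. -/
structure Stage.Good {I Y : Type*} [LinearOrder I] [TopologicalSpace Y] (𝒯 𝒜 : Set (Set Y))
    (T V : I → ℕ → Set Y) (i : I) (f : I → Stage I Y) (d : Stage I Y) : Prop where
  isClopen : ∀ n, IsClopen (d.W n)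
  disjoint : ∀ j ≤ i, ∀ᶠ n in atTop, Disjoint (d.W n) (T j n)
  big_inter : ∀ j < i, ∀ F : Finset I, (∀ x ∈ F, j < x ∧ x < i) → ∀ k, ∀ᶠ n in (f j).𝒰,
    Big 𝒯 n k ((f j).A n ∩ (⋂ x ∈ F, (f x).W n) ∩ d.W n)
  le_atTop : (d.𝒰 : Filter ℕ) ≤ atTop
  subset : ∀ n, d.A n ⊆ V i n
  mem : ∀ n, d.A n ∈ 𝒜 ∨ d.A n = ∅
  big : ∀ k, ∀ᶠ n in d.𝒰, Big 𝒯 n k (d.A n)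
  eq_false : ∀ j, i < j → d.z j = false
  decided : ∀ j < i, ∀ᶠ n in d.𝒰, ∀ y ∈ d.A n, (y ∈ (f j).W n ↔ d.z j = false)
  decided_self : ∀ᶠ n in d.𝒰, ∀ y ∈ d.A n, (y ∈ d.W n ↔ d.z i = false)

section Recursion

variable {I Y : Type*} [LinearOrder I] [TopologicalSpace Y] {𝒯 𝒜 : Set (Set Y)}
  {T V : I → ℕ → Set Y}

theorem Stage.Good.congr {i : I} {f g : I → Stage I Y} {d : Stage I Y}
    (h : ∀ j, j < i → f j = g j) (hd : d.Good 𝒯 𝒜 T V i f) : d.Good 𝒯 𝒜 T V i g where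
  isClopen := hd.isClopen
  disjoint := hd.disjoint
  big_inter j hj F hF k := by
    have := hd.big_inter j hj F hF k
    rw [h j hj] at this
    have e : ∀ n, ⋂ x ∈ F, (f x).W n = ⋂ x ∈ F, (g x).W n := fun n =>
      iInter₂_congr fun x hx => by rw [h x (hF x hx).2]
    simpa only [e] using this
  le_atTop := hd.le_atTop
  subset := hd.subset
  mem := hd.mem
  big := hd.big
  eq_false := hd.eq_false
  decided j hj := h j hj ▸ hd.decided j hj
  decided_self := hd.decided_self

/-- The largest `m ∈ F` was treated last, and its `big_inter` covers the other members of `F`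
together with its own `W`. -/
theorem Stage.Good.big_biInter {f : I → Stage I Y} {j : I} {F : Finset I}
    (hgood : ∀ x, x = j ∨ x ∈ F → (f x).Good 𝒯 𝒜 T V x f) (hF : ∀ x ∈ F, j < x) (k : ℕ) :
    ∀ᶠ n in (f j).𝒰, Big 𝒯 n k ((f j).A n ∩ ⋂ x ∈ F, (f x).W n) := by
  classical
  rcases F.eq_empty_or_nonempty with rfl | hne
  · simpa using (hgood j (Or.inl rfl)).big k
  · have hm := F.max'_mem hne
    set m := F.max' hne
    filter_upwards [(hgood m (Or.inr hm)).big_inter j (hF m hm) (F.erase m) (fun x hx =>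
      ⟨hF x (Finset.mem_of_mem_erase hx), F.lt_max'_of_mem_erase_max' hne hx⟩) k] with n hn
    refine hn.mono ?_
    rw [inter_assoc]
    refine inter_subset_inter_right _ fun y hy => mem_iInter₂.2 fun x hx => ?_
    by_cases hxm : x = m
    · exact hxm ▸ hy.2
    · exact mem_iInter₂.1 hy.1 x (Finset.mem_erase.2 ⟨hxm, hx⟩)

/-- There are countably many earlier stages and finite intersections of earlier `W`s, so the
diagonal lemma yields the new `W`; order `k` after intersecting with it needs order `k + 1` before.
Each new `A n` is taken on one side of the first `n` sets `W`, and the ultrafilter then decides the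
coordinates of `z`. -/
theorem exists_stage_good (hI : ∀ i : I, (Iic i).Countable) (hT : ∀ i n, T i n ∈ 𝒯)
    (hVo : ∀ i n, IsOpen (V i n)) (hV : ∀ i, ∃ᶠ n in atTop, (V i n).Nonempty)
    (h𝒜 : ∀ U : Set Y, IsOpen U → U.Nonempty → ∀ n k, ∃ A ∈ 𝒜, A ⊆ U ∧ Big 𝒯 n k A)
    (i : I) (f : I → Stage I Y) (hf : ∀ j, j < i → (f j).Good 𝒯 𝒜 T V j f) :
    ∃ d : Stage I Y, d.Good 𝒯 𝒜 T V i f := by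
  classical
  have hci : Countable (Iic i) := (hI i).to_subtype
  have hcj : Countable (Iio i) := ((hI i).mono Iio_subset_Iic_self).to_subtype
  have h𝒯 : 𝒯.Nonempty := ⟨_, hT i 0⟩
  obtain ⟨w, hwc, hwd, hwb⟩ := exists_isClopen_seq_big_inter (𝒯 := 𝒯)
    (countable_range fun (p : Iio i × Finset (Iio i)) n =>
      (f p.1).A n ∩ ⋂ x ∈ p.2, (f x).W n)
    (countable_range fun (j : Iic i) => T j) ⟨T i, ⟨⟨i, le_rfl⟩, rfl⟩⟩
    (by rintro _ ⟨j, rfl⟩ n; exact hT j n)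
  let W : I → ℕ → Set Y := fun j => if j = i then w else (f j).W
  have hWi : W i = w := if_pos rfl
  have hWj : ∀ j < i, W j = (f j).W := fun j hj => if_neg hj.ne
  have hWc : ∀ j ≤ i, ∀ n, IsClopen (W j n) := by
    intro j hj n
    rcases hj.eq_or_lt with rfl | hj
    · rw [hWi]; exact hwc n
    · rw [hWj j hj]; exact (hf j hj).isClopen n
  have : Nonempty (Iic i) := ⟨⟨i, le_rfl⟩⟩
  obtain ⟨e, he⟩ := exists_surjective_nat (Iic i)
  have hA : ∀ n, ∃ A : Set Y, (A ∈ 𝒜 ∨ A = ∅) ∧ A ⊆ V i n ∧ ((V i n).Nonempty → Big 𝒯 n n A ∧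
      ∀ l < n, A ⊆ W (e l) n ∨ Disjoint A (W (e l) n)) := by
    intro n
    by_cases hne : (V i n).Nonempty
    · obtain ⟨y, hy⟩ := hne
      let C : ℕ → Set Y := fun l => if y ∈ W (e l) n then W (e l) n else (W (e l) n)ᶜ
      have hCo : ∀ l, IsOpen (C l) := by
        intro l
        have := hWc (e l) (e l).2 n
        by_cases h : y ∈ W (e l) n
        · simpa [C, h] using this.isOpen
        · simpa [C, h] using this.isClosed.isOpen_compl
      have hyC : ∀ l, y ∈ C l := by
        intro l
        by_cases h : y ∈ W (e l) n <;> simp [C, h]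
      obtain ⟨A, hA, hAU, hAb⟩ := h𝒜 (V i n ∩ ⋂ l ∈ Finset.range n, C l)
        ((hVo i n).inter (isOpen_biInter_finset fun l _ => hCo l))
        ⟨y, hy, mem_iInter₂.2 fun l _ => hyC l⟩ n n
      refine ⟨A, Or.inl hA, hAU.trans inter_subset_left, fun _ => ⟨hAb, fun l hl => ?_⟩⟩
      have hAC : A ⊆ C l := fun a ha => mem_iInter₂.1 (hAU ha).2 l (Finset.mem_range.2 hl)
      by_cases h : y ∈ W (e l) n
      · left; simpa [C, h] using hAC
      · right; exact disjoint_left.2 fun a ha => by simpa [C, h] using hAC ha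
    · exact ⟨∅, Or.inr rfl, empty_subset _, fun h => absurd h hne⟩
  choose A hAm hAV hAn using hA
  have hne : (atTop ⊓ 𝓟 {n | (V i n).Nonempty} : Filter ℕ).NeBot :=
    frequently_mem_iff_neBot.1 (hV i)
  -- The ultrafilter must concentrate on the indices with `V i n` non-empty, since `A n` is empty
  -- elsewhere.
  let 𝒰 : Ultrafilter ℕ := Ultrafilter.of (atTop ⊓ 𝓟 {n | (V i n).Nonempty})
  have h𝒰 : (𝒰 : Filter ℕ) ≤ atTop := (Ultrafilter.of_le _).trans inf_le_left
  have h𝒰V : ∀ᶠ n in 𝒰, (V i n).Nonempty :=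
    le_principal_iff.1 ((Ultrafilter.of_le _).trans inf_le_right)
  -- Coordinates beyond `i` are `false`, i.e. inside `W j n`: later stages keep `A n` big within
  -- their `W`.
  let z : I → Bool := fun j => decide (j ≤ i ∧ ¬ ∀ᶠ n in 𝒰, A n ⊆ W j n)
  have hz : ∀ j ≤ i, ∀ᶠ n in 𝒰, ∀ y ∈ A n, (y ∈ W j n ↔ z j = false) := by
    intro j hj
    obtain ⟨l, hl⟩ := he ⟨j, hj⟩
    have h1 : ∀ᶠ n in 𝒰, A n ⊆ W j n ∨ Disjoint (A n) (W j n) := by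
      filter_upwards [h𝒰V, h𝒰 (eventually_gt_atTop l)] with n hn hln
      simpa [hl] using (hAn n hn).2 l hln
    by_cases h2 : ∀ᶠ n in 𝒰, A n ⊆ W j n
    · have hzj : z j = false := by simp [z, h2]
      filter_upwards [h2] with n hn y hy
      exact iff_of_true (hn hy) hzj
    · have hzj : z j = true := by simp only [z, h2, hj]; simp
      filter_upwards [(Ultrafilter.eventually_or.1 h1).resolve_left h2] with n hn y hy
      simp [hzj, disjoint_left.1 hn hy]
  refine ⟨⟨w, A, 𝒰, z⟩, hwc, fun j hj => hwd _ ⟨⟨j, hj⟩, rfl⟩, ?_, h𝒰, hAV, hAm, ?_, ?_, ?_, ?_⟩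
  · intro j hj F hF k
    filter_upwards [Stage.Good.big_biInter (𝒯 := 𝒯) (𝒜 := 𝒜) (T := T) (V := V) (f := f) (j := j)
        (F := F) (fun x hx => hf x (hx.elim (fun h => h ▸ hj) fun h => (hF x h).2))
        (fun x hx => (hF x hx).1) (k + 1),
      (hf j hj).le_atTop (hwb _ ⟨(⟨j, hj⟩, F.subtype (· ∈ Iio i)), rfl⟩ k)] with n h1 h2
    have e : ⋂ x ∈ F.subtype (· ∈ Iio i), (f x).W n = ⋂ x ∈ F, (f x).W n := by
      ext y
      simp only [mem_iInter, Finset.mem_subtype]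
      exact ⟨fun h x hx => h ⟨x, (hF x hx).2⟩ hx, fun h x hx => h x hx⟩
    simp only [e] at h2
    exact h2 h1
  · intro k
    filter_upwards [h𝒰V, h𝒰 (eventually_ge_atTop k)] with n hn hk
    exact (hAn n hn).1.of_le h𝒯 hk
  · intro j hj
    simp [z, hj]
  · intro j hj
    have := hz j hj.le
    rwa [hWj j hj] at this
  · have := hz i le_rfl
    rwa [hWi] at this

theorem exists_stages [WellFoundedLT I] (hI : ∀ i : I, (Iic i).Countable) (hT : ∀ i n, T i n ∈ 𝒯)
    (hVo : ∀ i n, IsOpen (V i n)) (hV : ∀ i, ∃ᶠ n in atTop, (V i n).Nonempty)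
    (h𝒜 : ∀ U : Set Y, IsOpen U → U.Nonempty → ∀ n k, ∃ A ∈ 𝒜, A ⊆ U ∧ Big 𝒯 n k A) :
    ∃ f : I → Stage I Y, ∀ i, (f i).Good 𝒯 𝒜 T V i f :=
  have : Nonempty (Stage I Y) := ⟨⟨fun _ => ∅, fun _ => ∅, pure 0, fun _ => false⟩⟩
  exists_forall_of_wellFounded wellFounded_lt _ (fun _ _ _ _ h hd => hd.congr h)
    (exists_stage_good hI hT hVo hV h𝒜)

/-- Clopen sequences `W i` that eventually avoid the sequences `T j`, `j ≤ i`, while every open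
sequence `V i` contains a sequence from `𝒜` accumulating at a point `z i` of countable support. -/
theorem exists_clopen_sequences [WellFoundedLT I] (hI : ∀ i : I, (Iic i).Countable)
    (hT : ∀ i n, T i n ∈ 𝒯) (hVo : ∀ i n, IsOpen (V i n))
    (hV : ∀ i, ∃ᶠ n in atTop, (V i n).Nonempty)
    (h𝒜 : ∀ U : Set Y, IsOpen U → U.Nonempty → ∀ n k, ∃ A ∈ 𝒜, A ⊆ U ∧ Big 𝒯 n k A) :
    ∃ (W : I → ℕ → Set Y) (A : I → ℕ → Set Y) (z : I → I → Bool),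
      (∀ i n, IsClopen (W i n)) ∧ (∀ j i, j ≤ i → ∀ᶠ n in atTop, Disjoint (W i n) (T j n)) ∧
      (∀ i n, A i n ⊆ V i n) ∧ (∀ i n, A i n ∈ 𝒜 ∨ A i n = ∅) ∧
      (∀ i, {j | z i j = true}.Countable) ∧
      ∀ i (F : Finset I), ∃ᶠ n in atTop, ∃ y ∈ A i n, ∀ j ∈ F, (y ∈ W j n ↔ z i j = false) := by
  classical
  obtain ⟨f, hf⟩ := exists_stages hI hT hVo hV h𝒜
  refine ⟨fun i => (f i).W, fun i => (f i).A, fun i => (f i).z, fun i => (hf i).isClopen,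
    fun j i => (hf i).disjoint j, fun i => (hf i).subset, fun i => (hf i).mem,
    fun i => (hI i).mono fun j hj => ?_, fun i F => ?_⟩
  · by_contra h
    have h1 := (hf i).eq_false j (not_le.1 h)
    simp_all
  · have h1 : ∀ᶠ n in (f i).𝒰, ∀ j ∈ F.filter (· ≤ i), ∀ y ∈ (f i).A n,
        (y ∈ (f j).W n ↔ (f i).z j = false) := by
      rw [Filter.eventually_all_finset]
      intro j hj
      rcases (Finset.mem_filter.1 hj).2.eq_or_lt with rfl | h
      · exact (hf j).decided_self
      · exact (hf i).decided j h
    -- Order `0` is non-emptiness: some point of `A` lies in all `W`s of index beyond `i`, while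
    -- `h1` settles the indices up to `i` for every point of `A`.
    have h2 := Stage.Good.big_biInter (f := f) (j := i) (F := F.filter (i < ·)) (fun x _ => hf x)
      (fun x hx => (Finset.mem_filter.1 hx).2) 0
    refine Filter.Frequently.filter_mono (Eventually.frequently ?_) (hf i).le_atTop
    filter_upwards [h1, h2] with n h3 h4
    obtain ⟨y, hy, hyW⟩ := h4
    refine ⟨y, hy, fun j hj => ?_⟩
    rcases le_or_gt j i with hji | hij
    · exact h3 j (Finset.mem_filter.2 ⟨hj, hji⟩) y hy
    · exact iff_of_true (mem_iInter₂.1 hyW j (Finset.mem_filter.2 ⟨hj, hij⟩))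
        ((hf i).eq_false j hij)

end Recursion

/-! ### The glued space and its topology. -/

/-- The `Σ`-product of `I` copies of the two-point space. -/
abbrev CountableSupport (I : Type*) := {z : I → Bool // {i | z i = true}.Countable}

/-- The disjoint union of countably many copies of `Y` and of a `Σ`-product, glued by the sets
`W i n`. -/
def Glue {I Y : Type*} (_ : I → ℕ → Set Y) := (ℕ × Y) ⊕ CountableSupport I

namespace Glue

variable {I Y : Type*} {W : I → ℕ → Set Y}

/-- The `n`-th copy of `Y`. -/
def level (W : I → ℕ → Set Y) (n : ℕ) (y : Y) : Glue W := Sum.inl (n, y)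

/-- The copy of the `Σ`-product. -/
def top (W : I → ℕ → Set Y) (z : CountableSupport I) : Glue W := Sum.inr z

theorem cases (x : Glue W) : (∃ n y, x = level W n y) ∨ ∃ z, x = top W z := by
  rcases x with ⟨n, y⟩ | z
  · exact Or.inl ⟨n, y, rfl⟩
  · exact Or.inr ⟨z, rfl⟩

theorem level_inj {n m : ℕ} {y y' : Y} (h : level W n y = level W m y') : n = m ∧ y = y' := by
  exact Prod.mk.inj (Sum.inl_injective h)

theorem top_inj {z z' : CountableSupport I} (h : top W z = top W z') : z = z' :=
  Sum.inr_injective h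

theorem level_ne_top {n : ℕ} {y : Y} {z : CountableSupport I} : level W n y ≠ top W z :=
  Sum.inl_ne_inr

open Classical in
/-- The embedding of the space into a compact space which defines its topology. -/
noncomputable def toProd (W : I → ℕ → Set Y) : Glue W → (ℕ → Y ⊕ Unit) × (I → Bool)
  | Sum.inl (m, y) => (fun n => if n = m then Sum.inl y else Sum.inr (), fun i => decide (y ∉ W i m))
  | Sum.inr z => (fun _ => Sum.inr (), z.1)

theorem toProd_level_fst_self (n : ℕ) (y : Y) : (toProd W (level W n y)).1 n = Sum.inl y :=
  if_pos rfl

theorem toProd_level_fst {n m : ℕ} (h : m ≠ n) (y : Y) :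
    (toProd W (level W n y)).1 m = Sum.inr () :=
  if_neg h

theorem toProd_level_snd (n : ℕ) (y : Y) (i : I) :
    (toProd W (level W n y)).2 i = false ↔ y ∈ W i n := by
  simp [toProd, level]

theorem toProd_top (z : CountableSupport I) : toProd W (top W z) = (fun _ => Sum.inr (), z.1) :=
  rfl

theorem toProd_injective : Function.Injective (toProd W) := by
  intro x x' h
  rcases cases x with ⟨n, y, rfl⟩ | ⟨z, rfl⟩ <;> rcases cases x' with ⟨m, y', rfl⟩ | ⟨z', rfl⟩
  · have h1 := congrFun (congrArg Prod.fst h) n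
    rw [toProd_level_fst_self] at h1
    by_cases hnm : n = m
    · subst hnm
      rw [toProd_level_fst_self] at h1
      rw [Sum.inl_injective h1]
    · rw [toProd_level_fst hnm] at h1
      simp at h1
  · have h1 := congrFun (congrArg Prod.fst h) n
    rw [toProd_level_fst_self] at h1
    simp [toProd_top] at h1
  · have h1 := congrFun (congrArg Prod.fst h) m
    rw [toProd_level_fst_self] at h1
    simp [toProd_top] at h1
  · rw [Subtype.ext (congrArg Prod.snd h : z.1 = z'.1)]

theorem range_level (n : ℕ) :
    range (level W n) = {x | (toProd W x).1 n ∈ range (Sum.inl : Y → Y ⊕ Unit)} := by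
  ext x
  rcases cases x with ⟨m, y, rfl⟩ | ⟨z, rfl⟩
  · by_cases h : n = m
    · subst h
      simp [toProd_level_fst_self]
    · simp only [mem_ofPred_eq, toProd_level_fst h]
      refine iff_of_false ?_ (by simp)
      rintro ⟨y', hy'⟩
      exact h (level_inj hy').1
  · refine iff_of_false ?_ (by simp [toProd_top])
    rintro ⟨y', hy'⟩
    exact level_ne_top hy'

variable [TopologicalSpace Y]

noncomputable instance : TopologicalSpace (Glue W) := .induced (toProd W) inferInstance

theorem continuous_toProd : Continuous (toProd W) := continuous_induced_dom

theorem isOpen_setOf_snd_eq (i : I) (b : Bool) : IsOpen {x : Glue W | (toProd W x).2 i = b} :=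
  ((continuous_apply i).comp (continuous_snd.comp continuous_toProd)).isOpen_preimage {b}
    (isOpen_discrete _)

theorem isEmbedding_toProd : IsEmbedding (toProd W) := ⟨⟨rfl⟩, toProd_injective⟩

instance [T2Space Y] : T2Space (Glue W) := isEmbedding_toProd.t2Space

theorem isZeroDimensional [CompactSpace Y] [T2Space Y] [TotallyDisconnectedSpace Y] :
    IsZeroDimensional (Glue W) := by
  have h := (isTopologicalBasis_isClopen (X := (ℕ → Y ⊕ Unit) × (I → Bool))).induced (toProd W)
  refine h.of_isOpen_of_subset (fun s hs => hs.isOpen) ?_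
  rintro _ ⟨s, hs, rfl⟩
  exact hs.preimage continuous_toProd

theorem isOpenEmbedding_level (hW : ∀ i n, IsClopen (W i n)) (n : ℕ) :
    IsOpenEmbedding (level W n) := by
  have hc : Continuous (level W n) := by
    refine continuous_induced_rng.2 (Continuous.prodMk (continuous_pi fun m => ?_)
      (continuous_pi fun i => ?_))
    · by_cases h : m = n
      · subst h
        simpa [level] using continuous_inl
      · simpa [level, h] using continuous_const
    · refine (continuous_bool_rng false).2 ?_
      convert hW i n using 1
      ext y
      exact toProd_level_snd n y i
  have hg : Continuous fun x : Glue W => (toProd W x).1 n :=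
    (continuous_apply n).comp (continuous_fst.comp continuous_toProd)
  refine ⟨⟨IsInducing.of_comp hc hg ?_, fun y y' h => (level_inj h).2⟩, ?_⟩
  · have e : (fun x : Glue W => (toProd W x).1 n) ∘ level W n = Sum.inl :=
      funext fun y => toProd_level_fst_self n y
    rw [e]
    exact IsOpenEmbedding.inl.isInducing
  · rw [range_level]
    exact IsOpenEmbedding.inl.isOpen_range.preimage hg

theorem continuous_top : Continuous (top W) :=
  continuous_induced_rng.2 (Continuous.prodMk continuous_const continuous_subtype_val)

theorem isClosed_range_top (hW : ∀ i n, IsClopen (W i n)) : IsClosed (range (top W)) := by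
  have e : range (top W) = (⋃ n, range (level W n))ᶜ := by
    ext x
    rcases cases x with ⟨m, y, rfl⟩ | ⟨z, rfl⟩
    · refine iff_of_false (fun ⟨z, hz⟩ => level_ne_top hz.symm) fun h => h ?_
      exact mem_iUnion.2 ⟨m, y, rfl⟩
    · refine iff_of_true ⟨z, rfl⟩ fun h => ?_
      obtain ⟨n, y, hy⟩ := mem_iUnion.1 h
      exact level_ne_top hy
  rw [e, isClosed_compl_iff]
  exact isOpen_iUnion fun n => (isOpenEmbedding_level hW n).isOpen_range

/-- A basic open set constrains finitely many levels and finitely many `i`; past those levels only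
the conditions on `i` remain. -/
theorem exists_nhds_top {z : CountableSupport I} {O : Set (Glue W)} (hO : IsOpen O)
    (hz : top W z ∈ O) : ∃ (N : ℕ) (F : Finset I),
      (∀ n ≥ N, ∀ y, (∀ i ∈ F, (y ∈ W i n ↔ z.1 i = false)) → level W n y ∈ O) ∧
      ∀ z' : CountableSupport I, (∀ i ∈ F, z'.1 i = z.1 i) → top W z' ∈ O := by
  obtain ⟨P, hP, rfl⟩ := isOpen_induced_iff.1 hO
  obtain ⟨u, v, hu, hv, hzu, hzv, huv⟩ := isOpen_prod_iff.1 hP _ _ hz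
  obtain ⟨E, s, hs, hsu⟩ := isOpen_pi_iff.1 hu _ hzu
  obtain ⟨F, t, ht, htv⟩ := isOpen_pi_iff.1 hv _ hzv
  refine ⟨E.sup id + 1, F, fun n hn y hy => huv ⟨hsu fun m hm => ?_, htv fun i hi => ?_⟩,
    fun z' hz' => huv ⟨hzu, htv fun i hi => ?_⟩⟩
  · have hmn : m ≠ n := by
      have : m ≤ E.sup id := Finset.le_sup (f := id) hm
      omega
    rw [toProd_level_fst hmn]
    exact (hs m hm).2
  · have e : (toProd W (level W n y)).2 i = z.1 i := by
      rw [Bool.eq_iff_iff, ← not_iff_not]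
      simpa using (toProd_level_snd n y i).trans (hy i hi)
    rw [e]
    exact (ht i hi).2
  · change z'.1 i ∈ t i
    rw [hz' i hi]
    exact (ht i hi).2

theorem perfectSpace [Infinite I] [T1Space Y] [PerfectSpace Y] (hW : ∀ i n, IsClopen (W i n)) :
    PerfectSpace (Glue W) := by
  classical
  refine ⟨preperfect_iff_nhds.2 fun x _ U hU => ?_⟩
  obtain ⟨O, hOU, hO, hxO⟩ := mem_nhds_iff.1 hU
  suffices h : ∃ y ∈ O, y ≠ x by
    obtain ⟨y, hy, hyx⟩ := h
    exact ⟨y, ⟨hOU hy, mem_univ _⟩, hyx⟩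
  rcases cases x with ⟨n, y, rfl⟩ | ⟨z, rfl⟩
  · have h1 : level W n ⁻¹' O ∈ 𝓝 y :=
      (hO.preimage (isOpenEmbedding_level hW n).continuous).mem_nhds hxO
    obtain ⟨y', hy', hne⟩ := (infinite_of_mem_nhds y h1).exists_notMem_finite (finite_singleton y)
    exact ⟨level W n y', hy', fun h => hne (level_inj h).2⟩
  · obtain ⟨N, F, -, hF⟩ := exists_nhds_top hO hxO
    obtain ⟨j, hj⟩ := Infinite.exists_notMem_finset F
    have hs : {i | Function.update z.1 j (!z.1 j) i = true}.Countable := by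
      refine (z.2.insert j).mono fun i hi => ?_
      by_cases hij : i = j
      · exact Or.inl hij
      · right
        simpa [hij] using hi
    refine ⟨top W ⟨_, hs⟩, hF _ fun i hi => ?_, fun h => ?_⟩
    · exact Function.update_of_ne (ne_of_mem_of_not_mem hi hj) _ _
    · have := congrFun (congrArg Subtype.val (top_inj h)) j
      simp at this

theorem _root_.SelPseudo.exists_countable_subset_closure [SecondCountableTopology Y] (S : Set Y) :
    ∃ B ⊆ S, B.Countable ∧ S ⊆ closure B := by
  obtain ⟨D, hD, hd⟩ := TopologicalSpace.exists_countable_dense S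
  refine ⟨Subtype.val '' D, by simp, hD.image _, fun x hx => ?_⟩
  exact image_closure_subset_closure_image continuous_subtype_val ⟨⟨x, hx⟩, hd _, rfl⟩

/-- A `Σ`-product is countably tight. -/
theorem exists_countable_forall_finset {S : Set (CountableSupport I)} (z : CountableSupport I)
    (h : ∀ F : Finset I, ∃ s ∈ S, ∀ i ∈ F, s.1 i = z.1 i) :
    ∃ B ⊆ S, B.Countable ∧ ∀ F : Finset I, ∃ s ∈ B, ∀ i ∈ F, s.1 i = z.1 i := by
  classical
  choose g hgS hg using h
  -- Closing off: add the supports of the points `g F` for finite `F` in the current set. Outside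
  -- the countable limit set, `z` and all `g F` with `F` inside it are `false`, so such `F` suffice.
  let next : Set I → Set I := fun C =>
    C ∪ ⋃ F : Finset C, {i | (g (F.map (Function.Embedding.subtype _))).1 i = true}
  let C : ℕ → Set I := fun k => next^[k] {i | z.1 i = true}
  have hCs : ∀ k, C (k + 1) = next (C k) := fun k => Function.iterate_succ_apply' _ _ _
  have hCc : ∀ k, (C k).Countable := by
    intro k
    induction k with
    | zero => exact z.2
    | succ k ih =>
      have := ih.to_subtype
      rw [hCs]
      exact ih.union (countable_iUnion fun F => (g _).2)
  have hmono : Monotone C := monotone_nat_of_le_succ fun k => by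
    rw [hCs]
    exact subset_union_left
  have hC : Countable (⋃ k, C k) := (countable_iUnion hCc).to_subtype
  refine ⟨range fun F : Finset (⋃ k, C k) => g (F.map (Function.Embedding.subtype _)),
    range_subset_iff.2 fun F => hgS _, countable_range _, fun F => ?_⟩
  refine ⟨_, ⟨F.subtype (· ∈ ⋃ k, C k), rfl⟩, fun i hi => ?_⟩
  by_cases hiC : i ∈ ⋃ k, C k
  · exact hg _ i (by simpa using ⟨hi, mem_iUnion.1 hiC⟩)
  · have hz : z.1 i = false := by
      by_contra h
      exact hiC (mem_iUnion.2 ⟨0, by simpa [C] using h⟩)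
    rw [hz]
    by_contra h
    set F' := (F.subtype (· ∈ ⋃ k, C k)).map (Function.Embedding.subtype _)
    obtain ⟨k, hk⟩ : ∃ k, (F' : Set I) ⊆ C k := by
      refine hmono.directed_le.exists_mem_subset_of_finset_subset_biUnion fun j hj => ?_
      simp only [F', Finset.coe_map, mem_image] at hj
      obtain ⟨j, -, rfl⟩ := hj
      exact j.2
    refine hiC (mem_iUnion.2 ⟨k + 1, ?_⟩)
    rw [hCs]
    refine Or.inr (mem_iUnion.2 ⟨F'.subtype (· ∈ C k), ?_⟩)
    have e : (F'.subtype (· ∈ C k)).map (Function.Embedding.subtype _) = F' := by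
      ext j
      simpa using fun hj => hk hj
    rw [e]
    exact (Bool.not_eq_false _).mp h

/-- The part of a set on the levels has a countable dense subset; a point in the closure of the
other part lies in the closed Σ-product, which is countably tight. -/
theorem isCountablyTight [SecondCountableTopology Y] (hW : ∀ i n, IsClopen (W i n)) :
    IsCountablyTight (Glue W) := by
  intro S x hx
  have hS : S = (⋃ n, level W n '' (level W n ⁻¹' S)) ∪ top W '' (top W ⁻¹' S) := by
    ext x
    rcases cases x with ⟨n, y, rfl⟩ | ⟨z, rfl⟩
    · simp only [mem_union, mem_iUnion]
      refine ⟨fun h => Or.inl ⟨n, y, h, rfl⟩, ?_⟩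
      rintro (⟨n, y, h, e⟩ | ⟨z, h, e⟩) <;> exact e ▸ h
    · simp only [mem_union, mem_iUnion]
      refine ⟨fun h => Or.inr ⟨z, h, rfl⟩, ?_⟩
      rintro (⟨n, y, h, e⟩ | ⟨z, h, e⟩) <;> exact e ▸ h
  rw [hS, closure_union] at hx
  rcases hx with hx | hx
  · choose B hBS hBc hB using fun n => exists_countable_subset_closure (level W n ⁻¹' S)
    refine ⟨⋃ n, level W n '' B n, iUnion_subset fun n => image_subset_iff.2 (hBS n),
      countable_iUnion fun n => (hBc n).image _, ?_⟩
    refine closure_minimal (iUnion_subset fun n => ?_) isClosed_closure hx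
    calc level W n '' (level W n ⁻¹' S) ⊆ level W n '' closure (B n) := image_mono (hB n)
      _ ⊆ closure (level W n '' B n) :=
        image_closure_subset_closure_image (isOpenEmbedding_level hW n).continuous
      _ ⊆ _ := closure_mono (subset_iUnion (fun n => level W n '' B n) n)
  · obtain ⟨z, rfl⟩ : x ∈ range (top W) :=
      closure_minimal (image_subset_range _ _) (isClosed_range_top hW) hx
    obtain ⟨B, hBS, hBc, hB⟩ := exists_countable_forall_finset (S := top W ⁻¹' S) z fun F => by
      obtain ⟨_, hF, s, hs, rfl⟩ := mem_closure_iff.1 hx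
        (⋂ i ∈ F, {x | (toProd W x).2 i = z.1 i})
        (isOpen_biInter_finset fun i _ => isOpen_setOf_snd_eq i _) (by simp [toProd_top])
      exact ⟨s, hs, fun i hi => mem_iInter₂.1 hF i hi⟩
    refine ⟨top W '' B, image_subset_iff.2 hBS, hBc.image _, mem_closure_iff.2 fun O hO hz => ?_⟩
    obtain ⟨N, F, -, hF⟩ := exists_nhds_top hO hz
    obtain ⟨s, hs, hsF⟩ := hB F
    exact ⟨_, hF s hsF, s, hs, rfl⟩

theorem isNice [Infinite I] [CompactSpace Y] [T2Space Y] [TotallyDisconnectedSpace Y]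
    [SecondCountableTopology Y] [PerfectSpace Y] (hW : ∀ i n, IsClopen (W i n)) :
    IsNice (Glue W) :=
  ⟨isCountablyTight hW, isZeroDimensional, inferInstance, perfectSpace hW⟩

/-- A point of countable support is `false` at some `i > j`. The open set where coordinate `i` is
`false` meets level `n` in the copy of `W i n`, which eventually misses `T n`. -/
theorem locallyFinite_level_image [LinearOrder I] [Uncountable I] (hI : ∀ i : I, (Iic i).Countable)
    (hW : ∀ i n, IsClopen (W i n)) {T : ℕ → Set Y} (j : I)
    (hT : ∀ i, j ≤ i → ∀ᶠ n in atTop, Disjoint (W i n) (T n)) :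
    LocallyFinite fun n => level W n '' T n := by
  intro x
  rcases cases x with ⟨n, y, rfl⟩ | ⟨z, rfl⟩
  · refine ⟨_, (isOpenEmbedding_level hW n).isOpen_range.mem_nhds ⟨y, rfl⟩,
      (finite_singleton n).subset ?_⟩
    rintro m ⟨_, ⟨y₁, -, rfl⟩, y₂, h⟩
    exact (level_inj h).1.symm
  · obtain ⟨i, hi⟩ : (Iic j ∪ {i | z.1 i = true})ᶜ.Nonempty := by
      rw [nonempty_compl]
      intro h
      exact not_countable_univ (h ▸ (hI j).union z.2)
    simp only [mem_compl_iff, mem_union, mem_Iic, mem_ofPred_eq, not_or, not_le,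
      Bool.not_eq_true] at hi
    refine ⟨_, (isOpen_setOf_snd_eq i false).mem_nhds hi.2, ?_⟩
    have := Nat.cofinite_eq_atTop ▸ hT i hi.1.le
    refine (eventually_cofinite.1 this).subset ?_
    rintro n ⟨_, ⟨y, hy, rfl⟩, h⟩
    exact fun hd => disjoint_left.1 hd ((toProd_level_snd n y i).1 h) hy

end Glue

/-! ### Selective pseudocompactness of the glued space. -/

theorem not_locallyFinite_of_frequently {X : Type*} [TopologicalSpace X] {A : ℕ → Set X} (x : X)
    (h : ∀ O, IsOpen O → x ∈ O → ∃ᶠ n in atTop, (A n ∩ O).Nonempty) : ¬ LocallyFinite A := by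
  intro hA
  obtain ⟨t, ht, hfin⟩ := hA x
  obtain ⟨O, hOt, hO, hx⟩ := mem_nhds_iff.1 ht
  refine Nat.frequently_atTop_iff_infinite.1 (h O hO hx) (hfin.subset fun n hn => ?_)
  exact hn.mono (inter_subset_inter_right _ hOt)

/-- If infinitely many `U n` meet a set all of whose sequences have limits along ultrafilters, then
one can choose at most one point from each `U n` so that the chosen points accumulate. -/
theorem exists_subsingleton_not_locallyFinite {X : Type*} [TopologicalSpace X] {K : Set X}
    (hK : ∀ x : ℕ → X, (∀ n, x n ∈ K) → ∀ 𝒰 : Ultrafilter ℕ, ∃ p, Tendsto x 𝒰 (𝓝 p))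
    {U : ℕ → Set X} (hU : ∃ᶠ n in atTop, (U n ∩ K).Nonempty) :
    ∃ A : ℕ → Set X, (∀ n, (A n).Subsingleton) ∧ (∀ n, A n ⊆ U n) ∧ ¬ LocallyFinite A := by
  obtain ⟨_, x₀, -, hx₀⟩ := hU.exists
  have hx : ∀ n, ∃ x ∈ K, (U n ∩ K).Nonempty → x ∈ U n := by
    intro n
    by_cases h : (U n ∩ K).Nonempty
    · exact ⟨h.some, h.some_mem.2, fun _ => h.some_mem.1⟩
    · exact ⟨x₀, hx₀, fun h' => absurd h' h⟩
  choose x hxK hxU using hx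
  have : (atTop ⊓ 𝓟 {n | (U n ∩ K).Nonempty} : Filter ℕ).NeBot := frequently_mem_iff_neBot.1 hU
  let 𝒰 : Ultrafilter ℕ := Ultrafilter.of (atTop ⊓ 𝓟 {n | (U n ∩ K).Nonempty})
  have h𝒰 : (𝒰 : Filter ℕ) ≤ atTop := (Ultrafilter.of_le _).trans inf_le_left
  have h𝒰U : ∀ᶠ n in 𝒰, (U n ∩ K).Nonempty :=
    le_principal_iff.1 ((Ultrafilter.of_le _).trans inf_le_right)
  obtain ⟨p, hp⟩ := hK x hxK 𝒰
  refine ⟨fun n => {x n} ∩ U n, fun n => subsingleton_singleton.anti inter_subset_left,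
    fun n => inter_subset_right, not_locallyFinite_of_frequently p fun O hO hpO => ?_⟩
  refine Frequently.filter_mono (Eventually.frequently ?_) h𝒰
  filter_upwards [h𝒰U, hp.eventually (hO.mem_nhds hpO)] with n h1 h2
  exact ⟨x n, ⟨rfl, hxU n h1⟩, h2⟩

namespace Glue

variable {I Y : Type*} [TopologicalSpace Y] {W : I → ℕ → Set Y}

/-- The support of the coordinatewise limit is contained in the union of the countably many
supports. -/
theorem exists_tendsto_top (x : ℕ → Glue W) (hx : ∀ n, x n ∈ range (top W)) (𝒰 : Ultrafilter ℕ) :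
    ∃ p, Tendsto x 𝒰 (𝓝 p) := by
  choose z hz using hx
  obtain rfl : (fun n => top W (z n)) = x := funext hz
  obtain ⟨p, -, hp⟩ := isCompact_univ.ultrafilter_le_nhds (𝒰.map fun n => (z n).1) (by simp)
  have hp' : Tendsto (fun n => (z n).1) 𝒰 (𝓝 p) := hp
  have hc : {i | p i = true}.Countable := by
    refine (countable_iUnion fun n => (z n).2).mono fun i hi => ?_
    have h1 : ∀ᶠ n in 𝒰, (z n).1 i ∈ ({true} : Set Bool) :=
      (tendsto_pi_nhds.1 hp' i).eventually ((isOpen_discrete _).mem_nhds hi)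
    obtain ⟨n, hn⟩ := h1.exists
    exact mem_iUnion.2 ⟨n, hn⟩
  refine ⟨top W ⟨p, hc⟩, (continuous_top.tendsto _).comp ?_⟩
  exact tendsto_subtype_rng.2 hp'

/-- The hypothesis says that each open sequence on the levels contains a sequence from `𝒜`
accumulating at a point of the `Σ`-product. -/
theorem sp [CompactSpace Y] {𝒜 : Set (Set Y)} (hW : ∀ i n, IsClopen (W i n))
    (h : ∀ V : ℕ → Set Y, (∀ n, IsOpen (V n)) → (∃ᶠ n in atTop, (V n).Nonempty) →
      ∃ (A : ℕ → Set Y) (z : CountableSupport I), (∀ n, A n ∈ 𝒜 ∨ A n = ∅) ∧ (∀ n, A n ⊆ V n) ∧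
        ∀ F : Finset I, ∃ᶠ n in atTop, ∃ y ∈ A n, ∀ i ∈ F, (y ∈ W i n ↔ z.1 i = false)) :
    SP (Glue W) {A | A.Subsingleton ∨ ∃ n, ∃ B ∈ 𝒜, A = level W n '' B} := by
  classical
  intro U hU hne
  -- If infinitely many `U n` meet the Σ-product or one fixed level, limits exist there. Otherwise
  -- the levels met tend to infinity.
  by_cases hA : ∃ᶠ n in atTop, (U n ∩ range (top W)).Nonempty
  · obtain ⟨A, h1, h2, h3⟩ := exists_subsingleton_not_locallyFinite exists_tendsto_top hA
    exact ⟨A, fun n => Or.inl (h1 n), h2, h3⟩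
  by_cases hB : ∃ m, ∃ᶠ n in atTop, (U n ∩ range (level W m)).Nonempty
  · obtain ⟨m, hm⟩ := hB
    obtain ⟨A, h1, h2, h3⟩ := exists_subsingleton_not_locallyFinite (fun x hx 𝒰 => by
      obtain ⟨p, -, hp⟩ := (isCompact_range (isOpenEmbedding_level hW m).continuous
        ).ultrafilter_le_nhds (𝒰.map x) (le_principal_iff.2
          (show ∀ᶠ n in (𝒰 : Filter ℕ), x n ∈ range (level W m) from Eventually.of_forall hx))
      exact ⟨p, hp⟩) hm
    exact ⟨A, fun n => Or.inl (h1 n), h2, h3⟩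
  simp only [not_exists, not_frequently] at hA hB
  have hk : ∀ n, ∃ m, (U n ∩ range (top W)).Nonempty ∨ (U n ∩ range (level W m)).Nonempty := by
    intro n
    obtain ⟨x, hx⟩ := hne n
    rcases cases x with ⟨m, y, rfl⟩ | ⟨z, rfl⟩
    · exact ⟨m, Or.inr ⟨_, hx, y, rfl⟩⟩
    · exact ⟨0, Or.inl ⟨_, hx, z, rfl⟩⟩
  choose k hk using hk
  have hkU : ∀ᶠ n in atTop, (U n ∩ range (level W (k n))).Nonempty :=
    hA.mono fun n hn => (hk n).resolve_left hn
  have hkt : Tendsto k atTop atTop := by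
    have h1 : Tendsto k atTop cofinite := by
      rw [Tendsto, le_cofinite_iff_eventually_ne]
      intro m
      rw [eventually_map]
      filter_upwards [hkU, hB m] with n h1 h2 h3
      exact h2 (h3 ▸ h1)
    rwa [Nat.cofinite_eq_atTop] at h1
  -- Several `U n` may be assigned to one level: `σ m` selects one of them, and the others receive
  -- the empty set.
  have hσ : ∀ m, ∃ n, (∃ n, k n = m ∧ (U n ∩ range (level W m)).Nonempty) →
      k n = m ∧ (U n ∩ range (level W m)).Nonempty := by
    intro m
    by_cases h : ∃ n, k n = m ∧ (U n ∩ range (level W m)).Nonempty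
    · exact ⟨h.choose, fun _ => h.choose_spec⟩
    · exact ⟨0, fun h' => absurd h' h⟩
  choose σ hσ using hσ
  obtain ⟨A, z, hA𝒜, hAV, hAz⟩ := h (fun m => {y | level W m y ∈ U (σ m) ∧ k (σ m) = m})
    (fun m => ((hU _).preimage (isOpenEmbedding_level hW m).continuous).and isOpen_const) (by
      refine hkt.frequently (hkU.mono fun n hn => ?_).frequently
      obtain ⟨h1, _, h2, y, rfl⟩ := hσ (k n) ⟨n, rfl, hn⟩
      exact ⟨y, h2, h1⟩)
  refine ⟨fun n => if σ (k n) = n then level W (k n) '' A (k n) else ∅, fun n => ?_, fun n => ?_,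
    not_locallyFinite_of_frequently (top W z) fun O hO hz => ?_⟩
  · by_cases hn : σ (k n) = n
    · rcases hA𝒜 (k n) with h1 | h1
      · exact Or.inr ⟨k n, _, h1, if_pos hn⟩
      · left; simp [h1]
    · left; simp [hn]
  · by_cases hn : σ (k n) = n
    · simp only [hn, if_true]
      rintro _ ⟨y, hy, rfl⟩
      have h1 : level W (k n) y ∈ U (σ (k n)) := (hAV _ hy).1
      rwa [hn] at h1
    · simp [hn]
  · obtain ⟨N, F, hF, -⟩ := exists_nhds_top hO hz
    have h1 := Nat.frequently_atTop_iff_infinite.1 ((hAz F).and_eventually (eventually_ge_atTop N))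
    refine Nat.frequently_atTop_iff_infinite.2 (Infinite.of_image k (h1.mono ?_))
    rintro m ⟨⟨y, hy, hyF⟩, hm⟩
    have hkm : k (σ m) = m := (hAV _ hy).2
    refine ⟨σ m, ⟨level W m y, ?_, hF m hm y hyF⟩, hkm⟩
    simp only [hkm, if_true]
    exact ⟨y, hy, rfl⟩

end Glue

/-! ### Listing sequences under the continuum hypothesis. -/

theorem mk_opens_le_continuum (Y : Type) [TopologicalSpace Y] [SecondCountableTopology Y] :
    #(TopologicalSpace.Opens Y) ≤ 𝔠 := by
  let b := TopologicalSpace.countableBasis Y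
  have hb := TopologicalSpace.isBasis_countableBasis Y
  let f : TopologicalSpace.Opens Y → Set b := fun U => {s | (s : Set Y) ⊆ U}
  have hf : Function.Injective f := by
    intro U V h
    ext y
    have key : ∀ U : TopologicalSpace.Opens Y, y ∈ U ↔ ∃ s ∈ f U, y ∈ (s : Set Y) := by
      intro U
      refine ⟨fun hy => ?_, fun ⟨s, hs, hy⟩ => hs hy⟩
      obtain ⟨s, hs, hys, hsU⟩ := hb.exists_subset_of_mem_open hy U.isOpen
      exact ⟨⟨s, hs⟩, hsU, hys⟩
    exact (key U).trans (h ▸ (key V).symm)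
  have : Countable b := (TopologicalSpace.countable_countableBasis Y).to_subtype
  calc #(TopologicalSpace.Opens Y) ≤ #(Set b) := Cardinal.mk_le_of_injective hf
    _ = 2 ^ #b := Cardinal.mk_set
    _ ≤ 2 ^ ℵ₀ := Cardinal.power_le_power_left two_ne_zero Cardinal.mk_le_aleph0
    _ = 𝔠 := Cardinal.two_power_aleph0

theorem exists_surjective_seq_opens {I Y : Type} [TopologicalSpace Y] [SecondCountableTopology Y]
    (hI : 𝔠 ≤ #I) (P : (ℕ → TopologicalSpace.Opens Y) → Prop) (hP : ∃ V, P V) :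
    ∃ e : I → ℕ → TopologicalSpace.Opens Y, (∀ i, P (e i)) ∧ ∀ V, P V → ∃ i, e i = V := by
  have h1 : #{V // P V} ≤ #I := by
    refine (Cardinal.mk_subtype_le _).trans (le_trans ?_ hI)
    calc #(ℕ → TopologicalSpace.Opens Y) = #(TopologicalSpace.Opens Y) ^ ℵ₀ := by simp
      _ ≤ 𝔠 ^ ℵ₀ := Cardinal.power_le_power_right (mk_opens_le_continuum Y)
      _ = 𝔠 := Cardinal.continuum_power_aleph0
  obtain ⟨g⟩ := h1
  have : Nonempty {V // P V} := let ⟨V, hV⟩ := hP; ⟨⟨V, hV⟩⟩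
  refine ⟨fun i => (Function.invFun g i).1, fun i => (Function.invFun g i).2, fun V hV => ?_⟩
  obtain ⟨i, hi⟩ := Function.invFun_surjective g.injective ⟨V, hV⟩
  exact ⟨i, congrArg Subtype.val hi⟩

/-- The spaces of the construction: under the continuum hypothesis there is a nice space, with
countably many clopen copies of `Y`, in which all sequences from `𝒯` along these copies are locally
finite, and which is selectively pseudocompact with respect to the copies of members of `𝒜`. -/
theorem exists_isNice_sp (hCH : (𝔠 : Cardinal.{0}) = ℵ₁) {Y : Type} [TopologicalSpace Y]
    [CompactSpace Y] [T2Space Y] [TotallyDisconnectedSpace Y] [SecondCountableTopology Y]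
    [PerfectSpace Y] [Nonempty Y] {𝒯 𝒜 : Set (Set Y)} (hne : 𝒯.Nonempty)
    (h𝒯 : ∀ t ∈ 𝒯, IsClosed t)
    (h𝒜 : ∀ U : Set Y, IsOpen U → U.Nonempty → ∀ n k, ∃ A ∈ 𝒜, A ⊆ U ∧ Big 𝒯 n k A) :
    ∃ (X : Type) (_ : TopologicalSpace X) (e : ℕ → Y → X), IsNice X ∧
      (∀ n, IsOpenEmbedding (e n)) ∧
      SP X {A | A.Subsingleton ∨ ∃ n, ∃ B ∈ 𝒜, A = e n '' B} ∧
      ∀ T : ℕ → Set Y, (∀ n, T n ∈ 𝒯) → LocallyFinite fun n => e n '' T n := by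
  -- The order type `ω₁` is uncountable with countable initial segments, and by hypothesis long
  -- enough to list continuum many sequences.
  let I : Type := (ℵ₁ : Cardinal.{0}).ord.ToType
  have hIc : #I = ℵ₁ := Cardinal.mk_ord_toType _
  have hII : ∀ i : I, (Iic i).Countable := by
    intro i
    have h1 : #(Iio i) < ℵ₁ := by simpa [hIc] using Cardinal.mk_Iio_lt i (by simp [I])
    rw [← Iio_insert]
    refine Countable.insert _ (Cardinal.le_aleph0_iff_set_countable.1 ?_)
    exact Order.lt_succ_iff.1 (h1.trans_eq Cardinal.succ_aleph0.symm)
  have : Uncountable I := by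
    rw [← Cardinal.aleph0_lt_mk_iff, hIc]
    exact Cardinal.aleph0_lt_aleph_one
  -- Members of `𝒯` are closed, so they are listed through their open complements.
  obtain ⟨T, hT, hTs⟩ := exists_surjective_seq_opens (I := I) (hCH.trans hIc.symm).le
    (fun T : ℕ → TopologicalSpace.Opens Y => ∀ n, (T n : Set Y)ᶜ ∈ 𝒯) (by
      obtain ⟨t, ht⟩ := hne
      exact ⟨fun _ => ⟨tᶜ, (h𝒯 t ht).isOpen_compl⟩, fun _ => by simpa using ht⟩)
  obtain ⟨V, hV, hVs⟩ := exists_surjective_seq_opens (I := I) (hCH.trans hIc.symm).le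
    (fun V : ℕ → TopologicalSpace.Opens Y => ∃ᶠ n in atTop, (V n : Set Y).Nonempty)
    ⟨fun _ => ⊤, Frequently.of_forall fun _ => univ_nonempty⟩
  obtain ⟨W, A, z, hW, hWT, hAV, hA𝒜, hz, hAz⟩ := exists_clopen_sequences (𝒯 := 𝒯) (𝒜 := 𝒜)
    (T := fun i n => (T i n : Set Y)ᶜ) (V := fun i n => (V i n : Set Y)) hII hT
    (fun i n => (V i n).isOpen) hV h𝒜
  refine ⟨Glue W, inferInstance, Glue.level W, Glue.isNice hW, Glue.isOpenEmbedding_level hW,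
    Glue.sp hW fun V' hV' hne' => ?_, fun T' hT' => ?_⟩
  · obtain ⟨i, hi⟩ := hVs (fun n => ⟨V' n, hV' n⟩) hne'
    exact ⟨A i, ⟨z i, hz i⟩, hA𝒜 i, fun n => by simpa [hi] using hAV i n, hAz i⟩
  · obtain ⟨j, hj⟩ := hTs (fun n => ⟨(T' n)ᶜ, (h𝒯 _ (hT' n)).isOpen_compl⟩)
      (fun n => by simpa using hT' n)
    exact Glue.locallyFinite_level_image hII hW j fun i hi => by simpa [hj] using hWT j i hi

/-- The levels themselves form an open sequence from which every selection is locally finite. -/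
theorem not_sp_of_locallyFinite {X Y : Type*} [TopologicalSpace X] [TopologicalSpace Y] [Nonempty Y]
    {e : ℕ → Y → X} (he : ∀ n, IsOpenEmbedding (e n)) {𝒯 : Set (Set Y)}
    (hlf : ∀ T : ℕ → Set Y, (∀ n, T n ∈ 𝒯) → LocallyFinite fun n => e n '' T n) {ℬ : Set (Set X)}
    (hℬ : ∀ n, ∀ B ∈ ℬ, B ⊆ range (e n) → ∃ T ∈ 𝒯, B ⊆ e n '' T) : ¬ SP X ℬ := by
  intro h
  obtain ⟨A, hA, hAe, hnlf⟩ := h (fun n => range (e n)) (fun n => (he n).isOpen_range)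
    fun n => range_nonempty _
  choose T hT hAT using fun n => hℬ n (A n) (hA n) (hAe n)
  exact hnlf ((hlf T hT).subset hAT)

/-! ### Scattered and nowhere dense sets under embeddings. -/

section Scattered

variable {X Y : Type*} [TopologicalSpace X] [TopologicalSpace Y] {e : Y → X}

theorem IsScattered.image (he : IsOpenEmbedding e) {B : Set Y} (hB : IsScattered B) :
    IsScattered (e '' B) := by
  rintro Z hZ ⟨_, hz⟩
  obtain ⟨y, hy, rfl⟩ := hZ hz
  obtain ⟨y, hyZ, V, hV, hVy⟩ := hB (e ⁻¹' Z) (fun x hx => by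
    obtain ⟨x', hx', h⟩ := hZ hx
    rwa [← he.injective h]) ⟨y, hz⟩
  refine ⟨e y, hyZ, e '' V, he.isOpenMap V hV, ?_⟩
  rw [← image_inter_preimage, hVy, image_singleton]

theorem IsScattered.preimage (he : Continuous e) (hi : Function.Injective e) {B : Set X}
    (hB : IsScattered B) : IsScattered (e ⁻¹' B) := by
  intro Z hZ hne
  obtain ⟨_, ⟨z, hz, rfl⟩, V, hV, hVz⟩ := hB (e '' Z) (image_subset_iff.2 hZ) (hne.image e)
  refine ⟨z, hz, e ⁻¹' V, hV.preimage he, ?_⟩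
  rw [← hi.preimage_image Z, ← preimage_inter, hVz, ← image_singleton, hi.preimage_image]

theorem isNowhereDense_preimage (he : IsOpenEmbedding e) {B : Set X}
    (hB : IsNowhereDense B) : IsNowhereDense (e ⁻¹' B) := by
  rw [IsNowhereDense, ← image_eq_empty (f := e), ← subset_empty_iff, ← hB]
  refine interior_maximal ?_ (he.isOpenMap _ isOpen_interior)
  calc e '' interior (closure (e ⁻¹' B)) ⊆ e '' closure (e ⁻¹' B) := image_mono interior_subset
    _ ⊆ closure (e '' (e ⁻¹' B)) := image_closure_subset_closure_image he.continuous
    _ ⊆ closure B := closure_mono (image_preimage_subset _ _)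

end Scattered

/-! ### Big sets in compact zero-dimensional spaces. -/

section Big

variable {Y : Type*} [TopologicalSpace Y] [CompactSpace Y] [T2Space Y] [TotallyDisconnectedSpace Y]

/-- Each round need remove at most `n` points, so more than `n * k` points outlast `k` rounds. -/
theorem big_singletons {n k : ℕ} {A : Set Y} (hA : A.Finite) (hc : n * k < A.ncard) :
    Big (Singletons Y) n k A := by
  induction k generalizing A with
  | zero => exact nonempty_of_ncard_ne_zero (by omega)
  | succ k ih =>
    intro s hs
    choose y hy using hs
    have hP : (y '' Iio n).Finite := (finite_Iio n).image y
    have hPn : (y '' Iio n).ncard ≤ n := (ncard_image_le (finite_Iio n)).trans (by simp)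
    obtain ⟨W, hW, hAW, hWP⟩ := exists_clopen_of_closed_subset_open
      (hA.subset sdiff_subset : (A \ y '' Iio n).Finite).isClosed hP.isClosed.isOpen_compl
      fun x hx => hx.2
    refine ⟨W, hW, fun i hi => ?_, ?_⟩
    · rw [hy i, disjoint_singleton_right]
      exact fun h => hWP h ⟨i, hi, rfl⟩
    · have hsub : A \ y '' Iio n ⊆ A ∩ W := fun x hx => ⟨hx.1, hAW hx⟩
      refine ih (hA.subset inter_subset_left) (lt_of_lt_of_le ?_ (ncard_le_ncard hsub
        (hA.subset inter_subset_left)))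
      have h1 := le_ncard_sdiff (y '' Iio n) A hP
      rw [Nat.mul_succ] at hc
      omega

/-- Finitely many closed nowhere dense sets have a dense open complement, so each round leaves a
non-empty open set. -/
theorem big_isNowhereDense {n k : ℕ} {V : Set Y} (hV : IsOpen V) (hne : V.Nonempty) :
    Big {T : Set Y | IsClosed T ∧ IsNowhereDense T} n k V := by
  induction k generalizing V with
  | zero => exact hne
  | succ k ih =>
    intro s hs
    have hd : Dense (⋂ i ∈ Iio n, (s i)ᶜ) :=
      dense_biInter_of_isOpen (fun i _ => (hs i).1.isOpen_compl) (finite_Iio n).countable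
        fun i _ => (isClosed_isNowhereDense_iff_compl.1 (hs i)).2
    have ho : IsOpen (⋂ i ∈ Iio n, (s i)ᶜ) :=
      (finite_Iio n).isOpen_biInter fun i _ => (hs i).1.isOpen_compl
    obtain ⟨y, hyV, hy⟩ := hd.inter_open_nonempty V hV hne
    obtain ⟨W, hW, hyW, hWV⟩ := compact_exists_isClopen_in_isOpen (hV.inter ho) ⟨hyV, hy⟩
    refine ⟨W, hW, fun i hi => disjoint_left.2 fun x hx => mem_iInter₂.1 (hWV hx).2 i hi,
      ih (hV.inter hW.isOpen) ⟨y, hyV, hyW⟩⟩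

/-- A non-empty `Z ⊆ closure A` without isolated points is not contained in `S`. For a clopen
neighbourhood `W` of a point of `Z \ S`, the set `Z ∩ W` again has no isolated points and lies in
`closure (A ∩ W)`. -/
theorem exists_isClopen_disjoint_not_isScattered {A S : Set Y} (hA : ¬ IsScattered (closure A))
    (hSc : IsClosed S) (hS : IsScattered S) :
    ∃ W, IsClopen W ∧ Disjoint W S ∧ ¬ IsScattered (closure (A ∩ W)) := by
  simp only [IsScattered, not_forall] at hA
  obtain ⟨Z, hZA, hne, hZ⟩ := hA
  have hZS : ¬ Z ⊆ S := fun h => hZ (hS Z h hne)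
  obtain ⟨z, hz, hzS⟩ := not_subset.1 hZS
  obtain ⟨W, hW, hzW, hWS⟩ := compact_exists_isClopen_in_isOpen hSc.isOpen_compl hzS
  refine ⟨W, hW, disjoint_left.2 fun x hx => hWS hx, fun h => hZ ?_⟩
  obtain ⟨y, hy, V, hV, hVy⟩ := h (Z ∩ W) (fun x hx => by
    rw [inter_comm]
    exact hW.isOpen.inter_closure ⟨hx.2, hZA hx.1⟩) ⟨z, hz, hzW⟩
  exact ⟨y, hy.1, V ∩ W, hV.inter hW.isOpen, by rw [← hVy, inter_assoc, inter_comm W]⟩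

theorem big_clScat {n k : ℕ} {A : Set Y} (hA : ¬ IsScattered (closure A)) :
    Big (ClScat Y) n k A := by
  induction k generalizing A with
  | zero =>
    refine nonempty_iff_ne_empty.2 ?_
    rintro rfl
    exact hA (by simpa using isScattered_of_finite finite_empty)
  | succ k ih =>
    intro s hs
    have key : ∀ m, ∃ W, IsClopen W ∧ (∀ i < m, Disjoint W (s i)) ∧
        ¬ IsScattered (closure (A ∩ W)) := by
      intro m
      induction m with
      | zero => exact ⟨univ, isClopen_univ, by simp, by simpa using hA⟩
      | succ m ihm =>
        obtain ⟨W, h1, h2, h3⟩ := ihm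
        obtain ⟨W', h1', h2', h3'⟩ := exists_isClopen_disjoint_not_isScattered h3 (hs m).1 (hs m).2
        refine ⟨W ∩ W', h1.inter h1', fun i hi => ?_, by rwa [← inter_assoc]⟩
        rcases Nat.lt_succ_iff_lt_or_eq.1 hi with hi | rfl
        · exact (h2 i hi).mono_left inter_subset_left
        · exact h2'.mono_left inter_subset_right
    obtain ⟨W, h1, h2, h3⟩ := key n
    exact ⟨W, h1, h2, ih h3⟩

end Big

/-! ### Big sets in the Cantor set. -/

section Cantor

theorem exists_cylinder_subset {U : Set (ℕ → Bool)} (hU : IsOpen U) {a : ℕ → Bool} (ha : a ∈ U) :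
    ∃ N, PiNat.cylinder a N ⊆ U := by
  obtain ⟨F, s, hs, hsU⟩ := isOpen_pi_iff.1 hU a ha
  refine ⟨F.sup id + 1, fun x hx => hsU fun i hi => ?_⟩
  rw [PiNat.mem_cylinder_iff.1 hx i (Nat.lt_succ_of_le (Finset.le_sup (f := id) hi))]
  exact (hs i hi).2

theorem isClopen_cylinder (a : ℕ → Bool) (N : ℕ) : IsClopen (PiNat.cylinder a N) := by
  rw [PiNat.cylinder_eq_pi]
  refine ⟨isClosed_set_pi fun i _ => isClosed_discrete _, PiNat.cylinder_eq_pi a N ▸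
    PiNat.isOpen_cylinder _ a N⟩

instance : PerfectSpace (ℕ → Bool) := by
  refine ⟨preperfect_iff_nhds.2 fun a _ U hU => ?_⟩
  obtain ⟨O, hOU, hO, haO⟩ := mem_nhds_iff.1 hU
  obtain ⟨N, hN⟩ := exists_cylinder_subset hO haO
  refine ⟨Function.update a N (!a N), ⟨hOU (hN fun i hi => ?_), mem_univ _⟩, fun h => ?_⟩
  · exact Function.update_of_ne hi.ne _ _
  · simpa using congrFun h N

theorem exists_isScattered_closure_not {U : Set (ℕ → Bool)} (hU : IsOpen U) (hne : U.Nonempty) :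
    ∃ A ⊆ U, IsScattered A ∧ ¬ IsScattered (closure A) := by
  obtain ⟨a, ha⟩ := hne
  obtain ⟨N, hN⟩ := exists_cylinder_subset hU ha
  -- In `A` the first `true` at an odd position from `N` on is followed only by `false`, so finitely
  -- many coordinates isolate each point. `Z` lies in the closure, since this `true` can be pushed
  -- arbitrarily far, and it has no isolated points because its even coordinates from `N` on are
  -- free.
  let A : Set (ℕ → Bool) := {x | (∀ i < N, x i = a i) ∧ ∃ m, N ≤ 2 * m + 1 ∧
    x (2 * m + 1) = true ∧ (∀ j < m, N ≤ 2 * j + 1 → x (2 * j + 1) = false) ∧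
    ∀ j > 2 * m + 1, x j = false}
  let Z : Set (ℕ → Bool) := {x | (∀ i < N, x i = a i) ∧ ∀ j, N ≤ 2 * j + 1 → x (2 * j + 1) = false}
  refine ⟨A, fun x hx => hN hx.1, ?_, fun h => ?_⟩
  · rintro S hS ⟨z, hz⟩
    obtain ⟨-, m, hm, hzm, hzlt, hzgt⟩ := hS hz
    refine ⟨z, hz, PiNat.cylinder z (2 * m + 2), PiNat.isOpen_cylinder _ _ _, ?_⟩
    refine Subset.antisymm ?_ (singleton_subset_iff.2 ⟨PiNat.self_mem_cylinder _ _, hz⟩)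
    rintro y ⟨hy, hyS⟩
    rw [PiNat.mem_cylinder_iff] at hy
    obtain ⟨-, m', hm', hym, hylt, hygt⟩ := hS hyS
    have e : m' = m := by
      rcases lt_trichotomy m' m with h | h | h
      · have h1 := hzlt m' h hm'
        rw [← hy _ (by omega), hym] at h1
        simp at h1
      · exact h
      · have h1 := hylt m h hm
        rw [hy _ (by omega), hzm] at h1
        simp at h1
    subst e
    funext j
    rcases le_or_gt j (2 * m' + 1) with hj | hj
    · exact hy j (by omega)
    · rw [hygt j hj, hzgt j hj]
  · have hZA : Z ⊆ closure A := by
      intro x hx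
      refine mem_closure_iff.2 fun O hO hxO => ?_
      obtain ⟨K, hK⟩ := exists_cylinder_subset hO hxO
      refine ⟨fun i => if i < 2 * (K + N) + 1 then x i else decide (i = 2 * (K + N) + 1),
        hK fun i hi => if_pos (by omega), fun i hi => ?_, K + N, by omega, by simp,
        fun j hj hjN => ?_, fun j hj => ?_⟩
      · exact (if_pos (by omega)).trans (hx.1 i hi)
      · exact (if_pos (by omega)).trans (hx.2 j hjN)
      · exact (if_neg (by omega)).trans (decide_eq_false (by omega))
    obtain ⟨z, hz, V, hV, hVz⟩ := h Z hZA ⟨fun i => if i < N then a i else false,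
      fun i hi => if_pos hi, fun j hj => if_neg (by omega)⟩
    obtain ⟨K, hK⟩ := exists_cylinder_subset hV (hVz ▸ mem_singleton z : z ∈ V ∩ Z).1
    have hu : Function.update z (2 * (K + N)) (!z (2 * (K + N))) ∈ V ∩ Z := by
      refine ⟨hK fun i hi => Function.update_of_ne (by omega) _ _, fun i hi => ?_, fun j hj => ?_⟩
      · exact (Function.update_of_ne (by omega) _ _).trans (hz.1 i hi)
      · exact (Function.update_of_ne (by omega) _ _).trans (hz.2 j hj)
    rw [hVz] at hu
    simpa using congrFun (mem_singleton_iff.1 hu) (2 * (K + N))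

/-- Induction on `k`: sets of order `k` are placed in disjoint clopen shells converging to a point
`a`, and `a` is added. Finitely many finite sets miss some shell, and moving to that shell costs one
round. -/
theorem exists_clScat_big {n k : ℕ} {U : Set (ℕ → Bool)} (hU : IsOpen U) (hne : U.Nonempty) :
    ∃ A ∈ ClScat (ℕ → Bool), A ⊆ U ∧ Big (FinSets (ℕ → Bool)) n k A := by
  induction k generalizing U with
  | zero =>
    obtain ⟨a, ha⟩ := hne
    exact ⟨{a}, ⟨isClosed_singleton, isScattered_of_finite (finite_singleton a)⟩,
      singleton_subset_iff.2 ha, singleton_nonempty a⟩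
  | succ k ih =>
    obtain ⟨a, ha⟩ := hne
    obtain ⟨N, hN⟩ := exists_cylinder_subset hU ha
    -- The `i`-th shell: the points that first differ from `a` at position `N + i`.
    let V : ℕ → Set (ℕ → Bool) := fun i => PiNat.cylinder a (N + i) ∩ {x | x (N + i) = !a (N + i)}
    have hV : ∀ i, IsClopen (V i) := fun i => (isClopen_cylinder a _).inter
      ((isClopen_discrete {!a (N + i)}).preimage (continuous_apply (N + i)))
    have hVne : ∀ i, (V i).Nonempty := fun i =>
      ⟨Function.update a (N + i) (!a (N + i)), fun j hj => Function.update_of_ne hj.ne _ _,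
        by simp⟩
    have hVlt : ∀ i j x, x ∈ V i → x ∈ V j → ¬ i < j := by
      intro i j x hi hj h
      have h1 := PiNat.mem_cylinder_iff.1 hj.1 (N + i) (by omega)
      have h2 : x (N + i) = !a (N + i) := hi.2
      simp [h1] at h2
    have hVinj : ∀ i j x, x ∈ V i → x ∈ V j → i = j := fun i j x hi hj =>
      le_antisymm (not_lt.1 (hVlt j i x hj hi)) (not_lt.1 (hVlt i j x hi hj))
    have hVa : ∀ i, a ∉ V i := fun i h => by simpa using h.2
    choose A hA hAV hAb using fun i => ih (hV i).isOpen (hVne i)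
    have hAcyl : {a} ∪ ⋃ i, A i ⊆ PiNat.cylinder a N := by
      refine union_subset (singleton_subset_iff.2 (PiNat.self_mem_cylinder _ _))
        (iUnion_subset fun i => ((hAV i).trans inter_subset_left).trans ?_)
      exact PiNat.cylinder_anti a (by omega)
    refine ⟨{a} ∪ ⋃ i, A i, ⟨isClosed_of_closure_subset fun x hx => ?_, fun Z hZ hZne => ?_⟩,
      hAcyl.trans hN, fun s hs => ?_⟩
    · by_contra hxA
      have hxa : x ≠ a := fun h => hxA (Or.inl h)
      have hd : ∃ d, x d ≠ a d := Function.ne_iff.1 hxa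
      classical
      have hxN : x ∈ PiNat.cylinder a N := closure_minimal hAcyl (isClopen_cylinder a N).isClosed hx
      have hdN : N ≤ Nat.find hd := by
        by_contra h
        exact Nat.find_spec hd (PiNat.mem_cylinder_iff.1 hxN _ (not_le.1 h))
      obtain ⟨i, hi⟩ := Nat.exists_eq_add_of_le hdN
      have hxV : x ∈ V i := by
        refine ⟨fun j hj => not_not.1 (Nat.find_min hd (hi ▸ hj)), ?_⟩
        have := Nat.find_spec hd
        rw [hi] at this
        exact Bool.eq_not_of_ne this
      obtain ⟨y, ⟨hyV, hyA⟩, hy⟩ := mem_closure_iff.1 hx (V i \ A i)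
        ((hV i).isOpen.sdiff (hA i).1) ⟨hxV, fun h => hxA (Or.inr (mem_iUnion.2 ⟨i, h⟩))⟩
      rcases hy with rfl | hy
      · exact hVa i hyV
      · obtain ⟨j, hj⟩ := mem_iUnion.1 hy
        obtain rfl := hVinj i j y hyV (hAV j hj)
        exact hyA hj
    · by_cases h : ∃ i, (Z ∩ V i).Nonempty
      · obtain ⟨i, hi⟩ := h
        obtain ⟨z, hz, O, hO, hOz⟩ := (hA i).2 (Z ∩ V i) (fun y hy => by
          rcases hZ hy.1 with rfl | h
          · exact absurd hy.2 (hVa i)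
          · obtain ⟨j, hj⟩ := mem_iUnion.1 h
            obtain rfl := hVinj i j y hy.2 (hAV j hj)
            exact hj) hi
        exact ⟨z, hz.1, O ∩ V i, hO.inter (hV i).isOpen, by
          rw [← hOz, inter_assoc, inter_comm (V i)]⟩
      · have hZa : Z ⊆ {a} := fun y hy => by
          rcases hZ hy with h1 | h1
          · exact h1
          · obtain ⟨j, hj⟩ := mem_iUnion.1 h1
            exact absurd ⟨j, y, hy, hAV j hj⟩ h
        obtain ⟨y, hy⟩ := hZne
        exact isScattered_of_finite (finite_singleton a) Z hZa ⟨y, hy⟩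
    · have hP : (⋃ i ∈ Iio n, s i).Finite := (finite_Iio n).biUnion fun i _ => hs i
      obtain ⟨i, hi⟩ : ∃ i, Disjoint (V i) (⋃ i ∈ Iio n, s i) := by
        by_contra! h
        choose p hpV hpP using fun i => not_disjoint_iff.1 (h i)
        exact infinite_of_injective_forall_mem
          (fun i j (hij : p i = p j) => hVinj i j (p i) (hpV i) (hij ▸ hpV j)) hpP hP
      refine ⟨V i, hV i, fun j hj => hi.mono_right (subset_biUnion_of_mem (u := s) hj), ?_⟩
      exact (hAb i).mono (subset_inter
        (subset_union_of_subset_right (subset_iUnion A i) _) (hAV i))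

end Cantor

/-! ### The four separating spaces. -/

section Separation

theorem exists_isNice_finSets_not_singletons (hCH : (𝔠 : Cardinal.{0}) = ℵ₁) :
    ∃ (X : Type) (_ : TopologicalSpace X), IsNice X ∧ SP X (FinSets X) ∧ ¬ SP X (Singletons X) := by
  obtain ⟨X, _, e, hX, he, hsp, hlf⟩ := exists_isNice_sp hCH (Y := ℕ → Bool)
    (𝒯 := Singletons _) (𝒜 := FinSets _) ⟨_, fun _ => false, rfl⟩
    (by rintro _ ⟨x, rfl⟩; exact isClosed_singleton) fun U hU hne n k => by
      obtain ⟨x, hx⟩ := hne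
      obtain ⟨A, hAU, hA, hc⟩ :=
        (infinite_of_mem_nhds x (hU.mem_nhds hx)).exists_subset_ncard_eq (n * k + 1)
      exact ⟨A, hA, hAU, big_singletons hA (by omega)⟩
  refine ⟨X, _, hX, hsp.mono ?_, not_sp_of_locallyFinite he hlf ?_⟩
  · rintro _ (h | ⟨n, B, hB, rfl⟩)
    · exact h.finite
    · exact Finite.image _ hB
  · rintro n _ ⟨x, rfl⟩ h
    obtain ⟨y, rfl⟩ := h rfl
    exact ⟨{y}, ⟨y, rfl⟩, by simp⟩

theorem exists_isNice_clScat_not_finSets (hCH : (𝔠 : Cardinal.{0}) = ℵ₁) :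
    ∃ (X : Type) (_ : TopologicalSpace X), IsNice X ∧ SP X (ClScat X) ∧ ¬ SP X (FinSets X) := by
  obtain ⟨X, _, e, hX, he, hsp, hlf⟩ := exists_isNice_sp hCH (Y := ℕ → Bool)
    (𝒯 := FinSets _) (𝒜 := ClScat _) ⟨∅, finite_empty⟩ (fun _ h => Finite.isClosed h)
    fun U hU hne n k => exists_clScat_big hU hne
  have := hX.hausdorff
  refine ⟨X, _, hX, hsp.mono ?_, not_sp_of_locallyFinite he hlf ?_⟩
  · rintro _ (h | ⟨n, B, hB, rfl⟩)
    · exact ⟨h.finite.isClosed, isScattered_of_finite h.finite⟩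
    -- Closedness passes from the level to the whole space because levels are compact.
    · exact ⟨(hB.1.isCompact.image (he n).continuous).isClosed, hB.2.image (he n)⟩
  · intro n B hB h
    exact ⟨e n ⁻¹' B, Finite.preimage (he n).injective.injOn hB,
      (image_preimage_eq_of_subset h).ge⟩

theorem exists_isNice_scat_not_clScat (hCH : (𝔠 : Cardinal.{0}) = ℵ₁) :
    ∃ (X : Type) (_ : TopologicalSpace X), IsNice X ∧ SP X (Scat X) ∧ ¬ SP X (ClScat X) := by
  obtain ⟨X, _, e, hX, he, hsp, hlf⟩ := exists_isNice_sp hCH (Y := ℕ → Bool)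
    (𝒯 := ClScat _) (𝒜 := Scat _) ⟨∅, isClosed_empty, isScattered_of_finite finite_empty⟩
    (fun _ h => h.1) fun U hU hne n k => by
      obtain ⟨A, hAU, hA, hcl⟩ := exists_isScattered_closure_not hU hne
      exact ⟨A, hA, hAU, big_clScat hcl⟩
  have := hX.hausdorff
  refine ⟨X, _, hX, hsp.mono ?_, not_sp_of_locallyFinite he hlf ?_⟩
  · rintro _ (h | ⟨n, B, hB, rfl⟩)
    · exact isScattered_of_finite h.finite
    · exact IsScattered.image (he n) hB
  · intro n B hB h
    exact ⟨e n ⁻¹' B, ⟨hB.1.preimage (he n).continuous,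
      hB.2.preimage (he n).continuous (he n).injective⟩, (image_preimage_eq_of_subset h).ge⟩

theorem exists_isNice_isPseudocompact_not_nwd (hCH : (𝔠 : Cardinal.{0}) = ℵ₁) :
    ∃ (X : Type) (_ : TopologicalSpace X), IsNice X ∧ IsPseudocompact X ∧ ¬ SP X (Nwd X) := by
  obtain ⟨X, _, e, hX, he, hsp, hlf⟩ := exists_isNice_sp hCH (Y := ℕ → Bool)
    (𝒯 := {T | IsClosed T ∧ IsNowhereDense T}) (𝒜 := univ)
    ⟨∅, isClosed_empty, isNowhereDense_empty⟩
    (fun _ h => h.1) fun U hU hne n k => ⟨U, mem_univ _, Subset.rfl, big_isNowhereDense hU hne⟩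
  refine ⟨X, _, hX, hsp.isPseudocompact, not_sp_of_locallyFinite he hlf ?_⟩
  intro n B hB h
  -- The closure is taken because members of `𝒯` must be closed.
  exact ⟨closure (e n ⁻¹' B), ⟨isClosed_closure,
    (isNowhereDense_preimage (he n) hB).closure⟩,
    (image_preimage_eq_of_subset h).ge.trans (image_mono subset_closure)⟩

end Separation

end SelPseudo

theorem mainTheorem1 :
    -- the chain of implications, for all crowded T1 spaces
    (∀ (X : Type*) [TopologicalSpace X] [T1Space X] [PerfectSpace X],
      (SelPseudo.SP X (SelPseudo.Singletons X) → SelPseudo.SP X (SelPseudo.FinSets X)) ∧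
      (SelPseudo.SP X (SelPseudo.FinSets X) → SelPseudo.SP X (SelPseudo.ClScat X)) ∧
      (SelPseudo.SP X (SelPseudo.ClScat X) → SelPseudo.SP X (SelPseudo.Scat X)) ∧
      (SelPseudo.SP X (SelPseudo.Scat X) → SelPseudo.SP X (SelPseudo.Nwd X)) ∧
      (SelPseudo.SP X (SelPseudo.Nwd X) → SelPseudo.IsPseudocompact X)) ∧
    -- under CH, the four separating spaces
    ((𝔠 : Cardinal.{0}) = ℵ₁ →
      (∃ (X₁ : Type) (_ : TopologicalSpace X₁), SelPseudo.IsNice X₁ ∧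
        SelPseudo.SP X₁ (SelPseudo.FinSets X₁) ∧ ¬ SelPseudo.SP X₁ (SelPseudo.Singletons X₁)) ∧
      (∃ (X₂ : Type) (_ : TopologicalSpace X₂), SelPseudo.IsNice X₂ ∧
        SelPseudo.SP X₂ (SelPseudo.ClScat X₂) ∧ ¬ SelPseudo.SP X₂ (SelPseudo.FinSets X₂)) ∧
      (∃ (X₃ : Type) (_ : TopologicalSpace X₃), SelPseudo.IsNice X₃ ∧
        SelPseudo.SP X₃ (SelPseudo.Scat X₃) ∧ ¬ SelPseudo.SP X₃ (SelPseudo.ClScat X₃)) ∧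
      (∃ (X₄ : Type) (_ : TopologicalSpace X₄), SelPseudo.IsNice X₄ ∧
        SelPseudo.IsPseudocompact X₄ ∧ ¬ SelPseudo.SP X₄ (SelPseudo.Nwd X₄))) :=
  ⟨fun X _ _ _ => SelPseudo.sp_implications X, fun hCH =>
    ⟨SelPseudo.exists_isNice_finSets_not_singletons hCH,
      SelPseudo.exists_isNice_clScat_not_finSets hCH,
      SelPseudo.exists_isNice_scat_not_clScat hCH,
      SelPseudo.exists_isNice_isPseudocompact_not_nwd hCH⟩⟩
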